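/- Let $r,p\ge 0$ and $k\ge 1$ be integers, let $a_{-r},\dots,a_p$, $\alpha_0,\dots,\alpha_k$, $\beta_0,\dots,\beta_{k-1}$ be real numbers with $a_{-r}\neq 0$, $a_p\neq 0$, $\alpha_k=1$ and $|\alpha_0|+|\beta_0|>0$, let $\lambda>0$ and $a\in\mathbb{R}\setminus\{0\}$. Put $\mathcal{A}(z)=\sum_{\ell=-r}^p a_\ell z^\ell$ for $z\in\mathbb{C}\setminus\{0\}$. Assume: 1. (consistency in space) $\sum_{\ell=-r}^p a_\ell=0$ and $\sum_{\ell=-r}^p \ell\,a_\ell=a$; 2. (consistency in time) $\sum_{\sigma=0}^k\alpha_\sigma=0$ and $\sum_{\sigma=0}^k\sigma\,\alpha_\sigma=\sum_{\sigma=0}^{k-1}\beta_\sigma$; 3. (stability) there is a constant $C>0$ such that for every $\Delta t\in(0,1]$, with $\Delta x=\Delta t/\lambda$, every real solution $(u_j^n)_{j\in\mathbb{Z},\,n\in\mathbb{N}}$ of $$\sum_{\sigma=0}^k\alpha_\sigma u_j^{n+\sigma}+\lambda\sum_{\sigma=0}^{k-1}\beta_\sigma\sum_{\ell=-r}^p a_\ell\,u_{j+\ell}^{n+\sigma}=0,\qquad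 j\in\mathbb{Z},\ n\in\mathbb{N},$$ satisfies $$\sup_{n\in\mathbb{N}}\sum_{j\in\mathbb{Z}}\Delta x\,|u_j^n|^2\le C\sum_{\sigma=0}^{k-1}\sum_{j\in\mathbb{Z}}\Delta x\,|u_j^\sigma|^2$$ (sums with values in $[0,+\infty]$); 4. $\mathcal{A}(e^{i\theta})\neq 0$ for all $\theta\in[-\pi,\pi]\setminus\{0\}$. Let $F(x_0,\dots,x_{p+r-1})=\sum_{\ell=-r}^{p-1}f_\ell\,x_{\ell+r}$, with $f_\ell=-\sum_{m=-r}^{\ell}a_m$, be the numerical flux, that is, the unique linear form such that $\sum_{\ell=-r}^p a_\ell u_{j+\ell}=F(u_{j-r+1},\dots,u_{j+p})-F(u_{j-r},\dots,u_{j+p-1})$ for all sequences $(u_j)_{j\in\mathbb{Z}}$ and all $j\in\mathbb{Z}$. For $u\in\mathbb{R}$, a boundary layer profile associated with $u$ is a real sequence $(v_j)_{j\in\mathbb{N}}$ such that (i) $v_0=\dots=v_{r-1}=-u$; (ii) $F(u+v_j,\dots,u+v_{j+p+r-1})=F(u,\dots,u)$ for all $j\ge 0$; (iii) $\lim_{j\to\infty}v_j=0$.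 Let $\mathcal{C}_{\rm num}$ be the set of all $u\in\mathbb{R}$ with which at least one boundary layer profile is associated. Then: - if $a>0$, then $\mathcal{C}_{\rm num}=\{0\}$ and the unique boundary layer profile associated with $0$ is the zero sequence; - if $a<0$, then $\mathcal{C}_{\rm num}=\mathbb{R}$, and for every $u\in\mathbb{R}$ there is a unique boundary layer profile $(v_j)_{j\in\mathbb{N}}$ associated with $u$; it decays exponentially, i.e. there are $C>0$ and $\rho\in(0,1)$ with $|v_j|\le C\rho^j$ for all $j\ge 0$; and $v_j=u\,w_j$ for all $j\ge 0$, where $(w_j)_{j\in\mathbb{N}}$ is the boundary layer profile associated with $1$. -/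

import Mathlib

noncomputable section

namespace MultistepScheme

/-- The symbol `𝒜(z) = ∑_{ℓ=-r}^{p} c_ℓ z^ℓ` of the space discretization (used for `z ≠ 0`). -/
def symbol (r p : ℕ) (c : ℤ → ℝ) (z : ℂ) : ℂ :=
  ∑ l ∈ Finset.Icc (-(r : ℤ)) (p : ℤ), (c l : ℂ) * z ^ l

/-- Consistency of the space discretization with the velocity `a`. -/
def SpaceConsistent (r p : ℕ) (c : ℤ → ℝ) (a : ℝ) : Prop :=
  ∑ l ∈ Finset.Icc (-(r : ℤ)) (p : ℤ), c l = 0 ∧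
    ∑ l ∈ Finset.Icc (-(r : ℤ)) (p : ℤ), (l : ℝ) * c l = a

/-- Consistency of the explicit linear multistep method with coefficients
`α_0, …, α_k` and `β_0, …, β_{k-1}`. -/
def TimeConsistent (k : ℕ) (α β : ℕ → ℝ) : Prop :=
  ∑ s ∈ Finset.range (k + 1), α s = 0 ∧
    ∑ s ∈ Finset.range (k + 1), (s : ℝ) * α s = ∑ s ∈ Finset.range k, β s

/-- `u n j` is a solution of the fully discrete scheme on the whole line, `j ∈ ℤ`, `n ∈ ℕ`. -/
def IsCauchySolution (r p k : ℕ) (c : ℤ → ℝ) (α β : ℕ → ℝ) (lam : ℝ) (u : ℕ → ℤ → ℝ) : Prop :=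
  ∀ (n : ℕ) (j : ℤ),
    ∑ s ∈ Finset.range (k + 1), α s * u (n + s) j +
      lam * ∑ s ∈ Finset.range k, β s *
        ∑ l ∈ Finset.Icc (-(r : ℤ)) (p : ℤ), c l * u (n + s) (j + l) = 0

/-- The quantity `∑_{j ∈ ℤ} Δx |v_j|²`, with value `∞` if `v` is not square summable. -/
def energy (dx : ℝ) (v : ℤ → ℝ) : ENNReal :=
  ∑' j : ℤ, ENNReal.ofReal (dx * |v j| ^ 2)

/-- `ℓ²`-stability for the Cauchy problem; here `λ = Δt / Δx` is fixed, so `Δx = Δt / λ`. -/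
def CauchyStable (r p k : ℕ) (c : ℤ → ℝ) (α β : ℕ → ℝ) (lam : ℝ) : Prop :=
  ∃ C : ℝ, 0 < C ∧ ∀ dt : ℝ, 0 < dt → dt ≤ 1 →
    ∀ u : ℕ → ℤ → ℝ, IsCauchySolution r p k c α β lam u →
      ⨆ n : ℕ, energy (dt / lam) (u n) ≤
        ENNReal.ofReal C * ∑ s ∈ Finset.range k, energy (dt / lam) (u s)

/-- The only root of the symbol on the unit circle is `z = 1` (that `1` is a root is part of
consistency). -/
def NoOtherRootOnCircle (r p : ℕ) (c : ℤ → ℝ) : Prop :=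
  ∀ θ : ℝ, θ ∈ Set.Icc (-Real.pi) Real.pi → θ ≠ 0 →
    symbol r p c (Complex.exp (Complex.I * (θ : ℂ))) ≠ 0

/-- The coefficients `f_ℓ`, `-r ≤ ℓ ≤ p - 1`, of the numerical flux. -/
def fluxCoeff (r : ℕ) (c : ℤ → ℝ) (l : ℤ) : ℝ :=
  -∑ m ∈ Finset.Icc (-(r : ℤ)) l, c m

/-- The linear numerical flux `F(x_0, …, x_{p+r-1}) = ∑_{ℓ=-r}^{p-1} f_ℓ x_{ℓ+r}`. It is the only
linear form that puts the scheme in conservative form, see `numericalFlux_conservative` and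
`numericalFlux_unique`. -/
def numericalFlux (r p : ℕ) (c : ℤ → ℝ) (x : Fin (r + p) → ℝ) : ℝ :=
  ∑ i : Fin (r + p), fluxCoeff r c ((i : ℤ) - r) * x i

theorem sum_Icc_shift (r n : ℕ) (g : ℤ → ℝ) :
    ∑ l ∈ Finset.Icc (-(r : ℤ)) ((n : ℤ) - r), g l =
      ∑ i ∈ Finset.range (n + 1), g ((i : ℤ) - r) := by
  symm
  refine Finset.sum_bij (fun i _ => (i : ℤ) - r) ?_ ?_ ?_ ?_
  · intro i hi
    simp only [Finset.mem_range, Finset.mem_Icc] at hi ⊢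
    omega
  · intro i _ j _ h
    have h' : (i : ℤ) - r = (j : ℤ) - r := h
    omega
  · intro l hl
    simp only [Finset.mem_Icc] at hl
    refine ⟨(l + r).toNat, ?_, ?_⟩
    · simp only [Finset.mem_range]
      omega
    · have h : ((l + r).toNat : ℤ) = l + r := Int.toNat_of_nonneg (by omega)
      rw [h]
      ring
  · intro i _
    rfl

theorem summation_by_parts (b y : ℕ → ℝ) (n : ℕ) :
    ∑ i ∈ Finset.range (n + 1), b i * y i =
      (∑ i ∈ Finset.range (n + 1), b i) * y n -
        ∑ i ∈ Finset.range n, (∑ m ∈ Finset.range (i + 1), b m) * (y (i + 1) - y i) := by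
  induction n with
  | zero => simp
  | succ n ih =>
    rw [Finset.sum_range_succ, ih, Finset.sum_range_succ b (n + 1),
      Finset.sum_range_succ (fun i => (∑ m ∈ Finset.range (i + 1), b m) * (y (i + 1) - y i)) n]
    ring

/-- The conservative form
`∑_ℓ c_ℓ x_{j+ℓ} = F(x_{j-r+1}, …, x_{j+p}) - F(x_{j-r}, …, x_{j+p-1})`. -/
theorem numericalFlux_conservative (r p : ℕ) (c : ℤ → ℝ)
    (hc : ∑ l ∈ Finset.Icc (-(r : ℤ)) (p : ℤ), c l = 0) (x : ℤ → ℝ) (j : ℤ) :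
    ∑ l ∈ Finset.Icc (-(r : ℤ)) (p : ℤ), c l * x (j + l) =
      numericalFlux r p c (fun i => x (j - r + 1 + (i : ℤ))) -
        numericalFlux r p c (fun i => x (j - r + (i : ℤ))) := by
  have hp : (p : ℤ) = ((r + p : ℕ) : ℤ) - r := by push_cast; ring
  rw [hp, sum_Icc_shift] at hc
  rw [hp, sum_Icc_shift, summation_by_parts (fun i => c ((i : ℤ) - r))
    (fun i => x (j + ((i : ℤ) - r))), hc]
  unfold numericalFlux
  rw [← Finset.sum_sub_distrib, Fin.sum_univ_eq_sum_range
    (fun i : ℕ => fluxCoeff r c ((i : ℤ) - r) * x (j - r + 1 + (i : ℤ)) -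
      fluxCoeff r c ((i : ℤ) - r) * x (j - r + (i : ℤ))), zero_mul, zero_sub,
    ← Finset.sum_neg_distrib]
  refine Finset.sum_congr rfl fun i _ => ?_
  rw [fluxCoeff, sum_Icc_shift]
  have h1 : j + (((i + 1 : ℕ) : ℤ) - r) = j - r + 1 + i := by push_cast; ring
  have h2 : j + ((i : ℤ) - r) = j - r + i := by ring
  rw [h1, h2]
  ring

/-- The conservative form determines the numerical flux. -/
theorem numericalFlux_unique (r p : ℕ) (c : ℤ → ℝ) (g : Fin (r + p) → ℝ)
    (hg : ∀ x : ℤ → ℝ, ∑ l ∈ Finset.Icc (-(r : ℤ)) (p : ℤ), c l * x l =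
      ∑ i, g i * x (-(r : ℤ) + 1 + (i : ℤ)) - ∑ i, g i * x (-(r : ℤ) + (i : ℤ)))
    (x : Fin (r + p) → ℝ) : numericalFlux r p c x = ∑ i, g i * x i := by
  unfold numericalFlux
  refine Finset.sum_congr rfl fun m _ => ?_
  congr 1
  have h := hg (fun t => if t ≤ (m : ℤ) - r then 1 else 0)
  have hm := m.2
  rw [← Finset.sum_sub_distrib, Finset.sum_eq_single m] at h
  · rw [if_neg (by omega), if_pos (by omega)] at h
    simp only [mul_ite, mul_one, mul_zero] at h
    rw [← Finset.sum_filter] at h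
    have hs : (Finset.Icc (-(r : ℤ)) (p : ℤ)).filter (fun t => t ≤ (m : ℤ) - r) =
        Finset.Icc (-(r : ℤ)) ((m : ℤ) - r) := by
      ext t
      simp only [Finset.mem_filter, Finset.mem_Icc]
      omega
    rw [hs] at h
    rw [fluxCoeff, h]
    ring
  · intro i _ hi
    have hi' : (i : ℕ) ≠ m := fun h => hi (Fin.ext h)
    by_cases h1 : (i : ℕ) < m
    · rw [if_pos (by omega), if_pos (by omega)]; ring
    · rw [if_neg (by omega), if_neg (by omega)]; ring
  · intro h0
    exact absurd (Finset.mem_univ m) h0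

/-- `v` is a boundary layer profile associated with the real number `u`. -/
structure IsBoundaryLayerProfile (r p : ℕ) (c : ℤ → ℝ) (u : ℝ) (v : ℕ → ℝ) : Prop where
  boundary : ∀ j : ℕ, j < r → v j = -u
  flux : ∀ j : ℕ, numericalFlux r p c (fun i => u + v (j + i)) = numericalFlux r p c (fun _ => u)
  limit : Filter.Tendsto v Filter.atTop (nhds 0)

/-- The set `𝒞_num` of all `u` for which a boundary layer profile exists. -/
def Cnum (r p : ℕ) (c : ℤ → ℝ) : Set ℝ :=
  {u : ℝ | ∃ v : ℕ → ℝ, IsBoundaryLayerProfile r p c u v}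

/-- Exponential decay at infinity. -/
def DecaysExponentially (v : ℕ → ℝ) : Prop :=
  ∃ C ρ : ℝ, 0 < C ∧ 0 < ρ ∧ ρ < 1 ∧ ∀ j : ℕ, |v j| ≤ C * ρ ^ j

end MultistepScheme

end

/-! Let `f = fluxPoly r p c`. The constant `u` cancels from the flux equation, so a profile is a
null sequence solving the linear recurrence with characteristic polynomial `f`. Such sequences only
see the roots of `f` in the open unit disk. If `N` is their number with multiplicity, the question
is how `N` compares with the `r` boundary conditions. For `N = r` the initial values determine
exactly one profile. For `N < r` the conditions are overdetermined: the recurrence applied to the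
constant data `-u` forces `u = 0`.

The claim is thus `N = r - 1` for `a > 0` and `N = r` for `a < 0`. The conservative form gives `(z -
1) f(z) = z^r 𝒜(z)` and `f(1) = a` (`pow_mul_symbol`, `fluxPoly_eval_one`). If `𝒜(z)` were a
negative real at some `|z| = 1`, the time polynomial would be negative at `1`, hence have a real
root `x > 1`, and the mode `x^n z^j` would violate stability
(`CauchyStable.symbol_add_mem_slitPlane`). So for `τ > 0` the quotient of `(z - 1) f + τ z^r` by
`z^r` avoids `(-∞, 0]` on the circle, and by Rouché this polynomial has `r` roots in the disk. For
small `τ` these are the roots of `f` in the disk, together with the perturbed root near `1`, which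
moves inside if `a > 0` and outside if `a < 0` (`exists_diskRootCount_perturb`). -/

namespace MultistepScheme

/-! ### Counting roots in the unit disk. -/

open Polynomial

/-- The number of roots in the open unit disk, with multiplicity. -/
noncomputable def diskRootCount (P : ℂ[X]) : ℕ := P.roots.countP (fun z => ‖z‖ < 1)

theorem circleIntegrable_inv_sub {a : ℂ} (ha : ‖a‖ ≠ 1) :
    CircleIntegrable (fun z => 1 / (z - a)) 0 1 := by
  refine ContinuousOn.circleIntegrable zero_le_one ?_
  refine ContinuousOn.div continuousOn_const (by fun_prop) ?_
  intro z hz h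
  rw [sub_eq_zero] at h
  subst h
  exact ha (by simpa using hz)

theorem circleIntegral_inv_sub {a : ℂ} (ha : ‖a‖ ≠ 1) :
    (∮ z in C(0, 1), 1 / (z - a)) = if ‖a‖ < 1 then 2 * Real.pi * Complex.I else 0 := by
  split_ifs with h
  · simp_rw [one_div]
    exact circleIntegral.integral_sub_inv_of_mem_ball (by simpa using h)
  · have h1 : 1 < ‖a‖ := lt_of_le_of_ne (not_lt.mp h) (Ne.symm ha)
    refine Complex.circleIntegral_eq_zero_of_differentiable_on_off_countable zero_le_one
      Set.countable_empty ?_ ?_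
    · refine ContinuousOn.div continuousOn_const (by fun_prop) ?_
      intro z hz h0
      rw [sub_eq_zero] at h0
      subst h0
      have : ‖z‖ ≤ 1 := by simpa using hz
      linarith
    · intro z hz
      refine DifferentiableAt.div (by fun_prop) (by fun_prop) ?_
      intro h0
      rw [sub_eq_zero] at h0
      subst h0
      have : ‖z‖ < 1 := by simpa using hz.1
      linarith

theorem circleIntegral_sum_inv_sub (s : Multiset ℂ) (hs : ∀ a ∈ s, ‖a‖ ≠ 1) :
    CircleIntegrable (fun z => (s.map fun a => 1 / (z - a)).sum) 0 1 ∧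
    (∮ z in C(0, 1), (s.map fun a => 1 / (z - a)).sum) =
      s.countP (fun z => ‖z‖ < 1) * (2 * Real.pi * Complex.I) := by
  induction s using Multiset.induction_on with
  | empty => simp [circleIntegral]
  | cons a s ih =>
    obtain ⟨h1, h2⟩ := ih fun b hb => hs b (Multiset.mem_cons_of_mem hb)
    have ha := hs a (Multiset.mem_cons_self a s)
    have h3 := circleIntegrable_inv_sub ha
    simp only [Multiset.map_cons, Multiset.sum_cons]
    refine ⟨h3.add h1, ?_⟩
    rw [circleIntegral.integral_add h3 h1, h2, circleIntegral_inv_sub ha, Multiset.countP_cons]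
    split_ifs <;> push_cast <;> ring

/-- The argument principle for polynomials on the unit disk. -/
theorem circleIntegral_derivative_div_eval (P : ℂ[X]) (hP : ∀ z : ℂ, ‖z‖ = 1 → P.eval z ≠ 0) :
    CircleIntegrable (fun z => P.derivative.eval z / P.eval z) 0 1 ∧
    (∮ z in C(0, 1), P.derivative.eval z / P.eval z) =
      diskRootCount P * (2 * Real.pi * Complex.I) := by
  have hroots : ∀ a ∈ P.roots, ‖a‖ ≠ 1 := fun a ha h => hP a h (isRoot_of_mem_roots ha)
  constructor
  · refine ContinuousOn.circleIntegrable zero_le_one ?_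
    exact ContinuousOn.div (by fun_prop) (by fun_prop) fun z hz => hP z (by simpa using hz)
  · unfold diskRootCount
    rw [← (circleIntegral_sum_inv_sub _ hroots).2]
    refine circleIntegral.integral_congr zero_le_one fun z hz => ?_
    exact (IsAlgClosed.splits P).eval_derivative_div_eval_of_ne_zero (hP z (by simpa using hz))

/-- A form of Rouché's theorem for polynomials on the unit disk. -/
theorem diskRootCount_eq_of_div_mem_slitPlane (P Q : ℂ[X])
    (h : ∀ z : ℂ, ‖z‖ = 1 → P.eval z / Q.eval z ∈ Complex.slitPlane) :
    diskRootCount P = diskRootCount Q := by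
  -- Since `x / 0 = 0` lies outside the slit plane, the hypothesis also excludes zeros of `Q`.
  have hP : ∀ z : ℂ, ‖z‖ = 1 → P.eval z ≠ 0 := fun z hz h0 =>
    Complex.slitPlane_ne_zero (h z hz) (by rw [h0, zero_div])
  have hQ : ∀ z : ℂ, ‖z‖ = 1 → Q.eval z ≠ 0 := fun z hz h0 =>
    Complex.slitPlane_ne_zero (h z hz) (by rw [h0, div_zero])
  obtain ⟨iP, eP⟩ := circleIntegral_derivative_div_eval P hP
  obtain ⟨iQ, eQ⟩ := circleIntegral_derivative_div_eval Q hQ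
  have h0 : (∮ z in C(0, 1), (P.derivative.eval z / P.eval z -
      Q.derivative.eval z / Q.eval z)) = 0 := by
    -- The difference of logarithmic derivatives has the single-valued primitive `log (P / Q)` along
    -- the circle.
    refine circleIntegral.integral_eq_zero_of_hasDerivWithinAt
      (f := fun z => Complex.log (P.eval z / Q.eval z)) zero_le_one fun z hz => ?_
    have hz1 : ‖z‖ = 1 := by simpa using hz
    have hd := (((P.hasDerivAt z).div (Q.hasDerivAt z) (hQ z hz1)).clog
      (h z hz1)).hasDerivWithinAt (s := Metric.sphere 0 1)
    refine hd.congr_deriv ?_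
    have := hP z hz1
    have := hQ z hz1
    change (P.derivative.eval z * Q.eval z - P.eval z * Q.derivative.eval z) / Q.eval z ^ 2 /
      (P.eval z / Q.eval z) = _
    field_simp
  rw [circleIntegral.integral_sub iP iQ, eP, eQ, ← sub_mul, mul_eq_zero, sub_eq_zero] at h0
  rcases h0 with h0 | h0
  · exact_mod_cast h0
  · exact absurd h0 Complex.two_pi_I_ne_zero

end MultistepScheme

/-! ### Linear recurrences as polynomials in the shift operator. -/

namespace MultistepScheme

open Polynomial Filter

/-- The shift operator on sequences. -/
noncomputable def shift : Module.End ℂ (ℕ → ℂ) := LinearMap.funLeft ℂ ℂ Nat.succ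

theorem shift_apply (v : ℕ → ℂ) (n : ℕ) : shift v n = v (n + 1) := rfl

theorem shift_pow_apply (i : ℕ) (v : ℕ → ℂ) (n : ℕ) : (shift ^ i) v n = v (n + i) := by
  induction i generalizing n with
  | zero => rfl
  | succ i ih => rw [pow_succ', Module.End.mul_apply, shift_apply, ih, add_right_comm, add_assoc]

theorem aeval_shift_apply (P : ℂ[X]) (v : ℕ → ℂ) (n : ℕ) :
    aeval shift P v n = ∑ i ∈ Finset.range (P.natDegree + 1), P.coeff i * v (n + i) := by
  rw [aeval_eq_sum_range, LinearMap.sum_apply, Finset.sum_apply]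
  simp [shift_pow_apply]

theorem aeval_shift_X_sub_C_apply (z : ℂ) (v : ℕ → ℂ) (n : ℕ) :
    aeval shift (X - C z) v n = v (n + 1) - z * v n := by
  simp [shift_apply]

theorem tendsto_aeval_shift (P : ℂ[X]) {v : ℕ → ℂ} (hv : Tendsto v atTop (nhds 0)) :
    Tendsto (aeval shift P v) atTop (nhds 0) := by
  have h : Tendsto (fun n => ∑ i ∈ Finset.range (P.natDegree + 1), P.coeff i * v (n + i)) atTop
      (nhds (∑ i ∈ Finset.range (P.natDegree + 1), P.coeff i * 0)) :=
    tendsto_finsetSum _ fun i _ => ((tendsto_add_atTop_iff_nat i).mpr hv).const_mul _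
  simp only [mul_zero, Finset.sum_const_zero] at h
  exact h.congr fun n => (aeval_shift_apply P v n).symm

/-- A sequence tending to zero that solves a recurrence without roots in the open unit disk is
zero. -/
theorem eq_zero_of_aeval_shift_of_one_le (s : Multiset ℂ) (hs : ∀ z ∈ s, 1 ≤ ‖z‖) {v : ℕ → ℂ}
    (hv : Tendsto v atTop (nhds 0)) (h : aeval shift (s.map fun z => X - C z).prod v = 0) :
    v = 0 := by
  induction s using Multiset.induction_on with
  | empty => simpa using h
  | cons z s ih =>
    refine ih (fun y hy => hs y (Multiset.mem_cons_of_mem hy)) ?_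
    have hz := hs z (Multiset.mem_cons_self z s)
    rw [Multiset.map_cons, Multiset.prod_cons, map_mul, Module.End.mul_apply] at h
    set w := aeval shift (s.map fun z => X - C z).prod v with hw
    have hw0 : Tendsto w atTop (nhds 0) := tendsto_aeval_shift _ hv
    have hrec : ∀ n, w (n + 1) = z * w n := fun n => by
      rw [← sub_eq_zero, ← aeval_shift_X_sub_C_apply, h, Pi.zero_apply]
    -- A geometric sequence of ratio at least `1` in modulus has nondecreasing norm, so it tends to
    -- zero only if it vanishes.
    have hmono : Monotone fun n => ‖w n‖ := monotone_nat_of_le_succ fun n => by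
      rw [hrec, norm_mul]
      exact le_mul_of_one_le_left (norm_nonneg _) hz
    funext n
    have := hmono.ge_of_tendsto hw0.norm n
    simpa using this

/-- The factors are inverted one at a time: a forcing of size `ρ ^ n` with `‖z‖ < ρ` is not resonant
and produces a solution of the same size. Multiple roots therefore cost no polynomial factor. -/
theorem exists_norm_le_of_aeval_shift (s : Multiset ℂ) {ρ : ℝ} (hs : ∀ z ∈ s, ‖z‖ < ρ)
    {v : ℕ → ℂ} (h : ∃ K : ℝ, ∀ n, ‖aeval shift (s.map fun z => X - C z).prod v n‖ ≤ K * ρ ^ n) :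
    ∃ K : ℝ, ∀ n, ‖v n‖ ≤ K * ρ ^ n := by
  induction s using Multiset.induction_on with
  | empty => simpa using h
  | cons z s ih =>
    refine ih (fun y hy => hs y (Multiset.mem_cons_of_mem hy)) ?_
    have hz := hs z (Multiset.mem_cons_self z s)
    rw [Multiset.map_cons, Multiset.prod_cons, map_mul] at h
    simp only [Module.End.mul_apply] at h
    set w := aeval shift (s.map fun z => X - C z).prod v with hw
    obtain ⟨K, hK⟩ := h
    have hρ : 0 ≤ ρ := (norm_nonneg z).trans hz.le
    have hgap : 0 < ρ - ‖z‖ := sub_pos.mpr hz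
    -- Any `M ≥ ‖w 0‖` with `‖z‖ * M + K ≤ ρ * M` propagates along the recurrence.
    refine ⟨max ‖w 0‖ (K / (ρ - ‖z‖)), fun n => ?_⟩
    induction n with
    | zero => simp
    | succ n ihn =>
      have hrec : w (n + 1) = z * w n + aeval shift (X - C z) w n := by
        rw [aeval_shift_X_sub_C_apply]; ring
      set M := max ‖w 0‖ (K / (ρ - ‖z‖))
      have hM : K ≤ M * (ρ - ‖z‖) := (div_le_iff₀ hgap).mp (le_max_right _ _)
      calc ‖w (n + 1)‖ ≤ ‖z‖ * ‖w n‖ + ‖aeval shift (X - C z) w n‖ := by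
            rw [hrec, ← norm_mul]; exact norm_add_le _ _
        _ ≤ ‖z‖ * (M * ρ ^ n) + K * ρ ^ n :=
            add_le_add (mul_le_mul_of_nonneg_left ihn (norm_nonneg _)) (hK n)
        _ ≤ ‖z‖ * (M * ρ ^ n) + M * (ρ - ‖z‖) * ρ ^ n := by gcongr
        _ = M * ρ ^ (n + 1) := by ring

theorem exists_lt_one_of_forall_norm_lt_one (s : Multiset ℂ) (hs : ∀ z ∈ s, ‖z‖ < 1) :
    ∃ ρ : ℝ, 0 < ρ ∧ ρ < 1 ∧ ∀ z ∈ s, ‖z‖ < ρ := by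
  induction s using Multiset.induction_on with
  | empty => exact ⟨1 / 2, by norm_num, by norm_num, by simp⟩
  | cons z s ih =>
    obtain ⟨ρ, h0, h1, h2⟩ := ih fun y hy => hs y (Multiset.mem_cons_of_mem hy)
    obtain ⟨t, ht, ht1⟩ := exists_between (hs z (Multiset.mem_cons_self z s))
    refine ⟨max t ρ, lt_max_of_lt_right h0, max_lt ht1 h1, fun y hy => ?_⟩
    rcases Multiset.mem_cons.mp hy with rfl | hy
    · exact lt_max_of_lt_left ht
    · exact lt_max_of_lt_right (h2 y hy)

/-- A sequence that solves a recurrence with all roots in the open unit disk decays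
exponentially. -/
theorem exists_exponential_bound (s : Multiset ℂ) (hs : ∀ z ∈ s, ‖z‖ < 1) {v : ℕ → ℂ}
    (h : aeval shift (s.map fun z => X - C z).prod v = 0) :
    ∃ K ρ : ℝ, 0 < K ∧ 0 < ρ ∧ ρ < 1 ∧ ∀ n, ‖v n‖ ≤ K * ρ ^ n := by
  obtain ⟨ρ, h0, h1, h2⟩ := exists_lt_one_of_forall_norm_lt_one s hs
  obtain ⟨K, hK⟩ := exists_norm_le_of_aeval_shift s h2 (v := v) ⟨0, fun n => by simp [h]⟩
  exact ⟨max K 1, ρ, lt_max_of_lt_right one_pos, h0, h1, fun n => (hK n).trans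
    (mul_le_mul_of_nonneg_right (le_max_left _ _) (pow_nonneg h0.le n))⟩

theorem aeval_shift_eq_zero_iff_of_monic {Q : ℂ[X]} (hQ : Q.Monic) (v : ℕ → ℂ) :
    aeval shift Q v = 0 ↔
      (LinearRecurrence.mk Q.natDegree fun i => -Q.coeff i).IsSolution v := by
  rw [funext_iff]
  refine forall_congr' fun n => ?_
  rw [aeval_shift_apply, Finset.sum_range_succ, hQ.coeff_natDegree, one_mul, Pi.zero_apply,
    ← Fin.sum_univ_eq_sum_range (fun i => Q.coeff i * v (n + i)), add_comm, ← eq_neg_iff_add_eq_zero,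
    ← Finset.sum_neg_distrib]
  simp only [neg_mul]

theorem eq_zero_of_aeval_shift_of_initial {Q : ℂ[X]} (hQ : Q.Monic) {v : ℕ → ℂ}
    (h : aeval shift Q v = 0) (h0 : ∀ j < Q.natDegree, v j = 0) : v = 0 := by
  funext n
  induction n using Nat.strong_induction_on with
  | _ n ih =>
    by_cases hn : n < Q.natDegree
    · exact h0 n hn
    · have h1 := (aeval_shift_eq_zero_iff_of_monic hQ v).mp h (n - Q.natDegree)
      simp only at h1
      rw [Nat.sub_add_cancel (not_lt.mp hn)] at h1
      rw [h1, Pi.zero_apply]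
      refine Finset.sum_eq_zero fun i _ => ?_
      rw [ih _ (by omega), Pi.zero_apply, mul_zero]

theorem exists_aeval_shift_eq_zero {Q : ℂ[X]} (hQ : Q.Monic) (b : ℂ) :
    ∃ v : ℕ → ℂ, aeval shift Q v = 0 ∧ ∀ j < Q.natDegree, v j = b := by
  let E : LinearRecurrence ℂ := ⟨Q.natDegree, fun i => -Q.coeff i⟩
  exact ⟨E.mkSol fun _ => b, (aeval_shift_eq_zero_iff_of_monic hQ _).mpr (E.is_sol_mkSol _),
    fun j hj => E.mkSol_eq_init (fun _ => b) ⟨j, hj⟩⟩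

end MultistepScheme

/-! ### What stability implies for the symbol. -/

namespace MultistepScheme

open Polynomial

/-- The solution of the scheme with prescribed first `k` time levels. -/
noncomputable def cauchySol (r p k : ℕ) (c : ℤ → ℝ) (α β : ℕ → ℝ) (lam : ℝ)
    (init : ℕ → ℤ → ℝ) : ℕ → ℤ → ℝ
  | n =>
    if h : n < k then init n
    else fun j => -(∑ s : Fin k,
      have _ : n - k + s < n := by omega
      (α s * cauchySol r p k c α β lam init (n - k + s) j + lam * (β s *
        ∑ l ∈ Finset.Icc (-(r : ℤ)) (p : ℤ),
          c l * cauchySol r p k c α β lam init (n - k + s) (j + l))))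

variable {r p k : ℕ} {c : ℤ → ℝ} {α β : ℕ → ℝ} {lam : ℝ}

theorem isCauchySolution_iff (hαk : α k = 1) (u : ℕ → ℤ → ℝ) :
    IsCauchySolution r p k c α β lam u ↔ ∀ n j, u (n + k) j = -(∑ s : Fin k,
      (α s * u (n + s) j + lam * (β s *
        ∑ l ∈ Finset.Icc (-(r : ℤ)) (p : ℤ), c l * u (n + s) (j + l)))) := by
  refine forall_congr' fun n => forall_congr' fun j => ?_
  rw [Finset.sum_range_succ, hαk, one_mul, eq_neg_iff_add_eq_zero,
    Fin.sum_univ_eq_sum_range (fun s : ℕ => α s * u (n + s) j + lam * (β s *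
        ∑ l ∈ Finset.Icc (-(r : ℤ)) (p : ℤ), c l * u (n + s) (j + l))), Finset.sum_add_distrib,
    ← Finset.mul_sum]
  constructor <;> intro h <;> linarith

theorem isCauchySolution_cauchySol (hαk : α k = 1) (init : ℕ → ℤ → ℝ) :
    IsCauchySolution r p k c α β lam (cauchySol r p k c α β lam init) := by
  rw [isCauchySolution_iff hαk]
  intro n j
  rw [cauchySol]
  simp

theorem cauchySol_of_lt (init : ℕ → ℤ → ℝ) {s : ℕ} (hs : s < k) :
    cauchySol r p k c α β lam init s = init s := by
  rw [cauchySol, dif_pos hs]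

/-- Finite speed of propagation. -/
theorem IsCauchySolution.eq_of_eq_initial (hαk : α k = 1) {u v : ℕ → ℤ → ℝ}
    (hu : IsCauchySolution r p k c α β lam u) (hv : IsCauchySolution r p k c α β lam v) (M : ℕ)
    (h : ∀ s < k, ∀ j : ℤ, j.natAbs ≤ M → u s j = v s j) (n : ℕ) :
    ∀ j : ℤ, j.natAbs + n * (r + p) ≤ M → u n j = v n j := by
  rw [isCauchySolution_iff hαk] at hu hv
  induction n using Nat.strong_induction_on with
  | _ n ih =>
    intro j hj
    by_cases hn : n < k
    · exact h n hn j ((Nat.le_add_right _ _).trans hj)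
    · obtain ⟨m, rfl⟩ := Nat.exists_eq_add_of_le' (not_lt.mp hn)
      rw [hu, hv]
      refine congrArg Neg.neg (Finset.sum_congr rfl fun s _ => ?_)
      have hs := s.2
      -- The levels `m + s` with `s < k` lie at least one step back, and one step widens the domain
      -- of dependence by at most `r + p`.
      have h1 : (m + s + 1) * (r + p) ≤ (m + k) * (r + p) := Nat.mul_le_mul_right _ (by omega)
      rw [add_mul, one_mul] at h1
      rw [ih (m + s) (by omega) j (by omega)]
      congr 3
      refine Finset.sum_congr rfl fun l hl => ?_
      rw [Finset.mem_Icc] at hl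
      rw [ih (m + s) (by omega) (j + l) (by omega)]

theorem energy_of_support {dx : ℝ} (hdx : 0 ≤ dx) {v : ℤ → ℝ} (s : Finset ℤ)
    (hv : ∀ j ∉ s, v j = 0) : energy dx v = ENNReal.ofReal (dx * ∑ j ∈ s, v j ^ 2) := by
  unfold energy
  rw [tsum_eq_sum (s := s) fun j hj => by simp [hv j hj], Finset.mul_sum,
    ENNReal.ofReal_sum_of_nonneg fun j _ => by positivity]
  simp only [sq_abs]

theorem le_energy {dx : ℝ} (hdx : 0 ≤ dx) (v : ℤ → ℝ) (s : Finset ℤ) :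
    ENNReal.ofReal (dx * ∑ j ∈ s, v j ^ 2) ≤ energy dx v := by
  rw [Finset.mul_sum, ENNReal.ofReal_sum_of_nonneg fun j _ => by positivity]
  simp only [← sq_abs (v _)]
  exact ENNReal.sum_le_tsum s

/-- Localized form of the stability estimate. -/
theorem CauchyStable.exists_local_bound (hαk : α k = 1) (hlam : 0 < lam)
    (hst : CauchyStable r p k c α β lam) :
    ∃ K : ℝ, 0 < K ∧ ∀ v : ℕ → ℤ → ℝ, IsCauchySolution r p k c α β lam v → ∀ n M : ℕ,
      ∑ j ∈ Finset.Icc (-(M : ℤ)) M, v n j ^ 2 ≤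
        K * ∑ s ∈ Finset.range k,
          ∑ j ∈ Finset.Icc (-((M + n * (r + p) : ℕ) : ℤ)) (M + n * (r + p) : ℕ), v s j ^ 2 := by
  obtain ⟨K, hK, hest⟩ := hst
  refine ⟨K, hK, fun v hv n M => ?_⟩
  set N := M + n * (r + p) with hN
  -- Truncating the data makes the energies finite. By finite speed of propagation, the solution is
  -- unchanged on the window of radius `M` at time `n`.
  let init : ℕ → ℤ → ℝ := fun s j => if j ∈ Finset.Icc (-(N : ℤ)) N then v s j else 0
  set u := cauchySol r p k c α β lam init with hu
  have hsol : IsCauchySolution r p k c α β lam u := isCauchySolution_cauchySol hαk init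
  have huv : ∀ j ∈ Finset.Icc (-(M : ℤ)) M, u n j = v n j := fun j hj => by
    rw [Finset.mem_Icc] at hj
    refine hsol.eq_of_eq_initial hαk hv N (fun s hs i hi => ?_) n j (by omega)
    rw [hu, cauchySol_of_lt init hs]
    exact if_pos (Finset.mem_Icc.mpr (by omega))
  have hdx : 0 < 1 / lam := one_div_pos.mpr hlam
  have henergy : ∀ s ∈ Finset.range k, energy (1 / lam) (u s) =
      ENNReal.ofReal (1 / lam * ∑ j ∈ Finset.Icc (-(N : ℤ)) N, v s j ^ 2) := fun s hs => by
    rw [hu, cauchySol_of_lt init (Finset.mem_range.mp hs),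
      energy_of_support hdx.le (Finset.Icc (-(N : ℤ)) N) fun j hj => if_neg hj]
    congr 2
    exact Finset.sum_congr rfl fun j hj => by rw [if_pos hj]
  -- The single time step `dt = 1` suffices, because the factor `Δx` cancels.
  have h1 := (le_energy hdx.le (u n) (Finset.Icc (-(M : ℤ)) M)).trans
    ((le_iSup (fun n => energy (1 / lam) (u n)) n).trans (hest 1 one_pos le_rfl u hsol))
  rw [Finset.sum_congr rfl henergy, ← ENNReal.ofReal_sum_of_nonneg fun s _ => by positivity,
    ← ENNReal.ofReal_mul hK.le, ENNReal.ofReal_le_ofReal_iff (by positivity),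
    Finset.sum_congr rfl fun j hj => by rw [huv j hj], ← Finset.mul_sum] at h1
  rw [mul_left_comm] at h1
  exact le_of_mul_le_mul_left h1 hdx

/-- The sequence `z ^ j` is an eigenvector of the space operator with eigenvalue `t`. As `t` is
real, a real-linear `L` preserves this and yields real solutions. -/
theorem isCauchySolution_mode {z : ℂ} (hz : z ≠ 0) {t : ℝ} (ht : symbol r p c z = t) {g : ℕ → ℝ}
    (hg : ∀ n, ∑ s ∈ Finset.range (k + 1), α s * g (n + s) +
      lam * t * ∑ s ∈ Finset.range k, β s * g (n + s) = 0) (L : ℂ →ₗ[ℝ] ℝ) :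
    IsCauchySolution r p k c α β lam fun n j => g n * L (z ^ j) := by
  have hsum : ∀ j : ℤ, ∑ l ∈ Finset.Icc (-(r : ℤ)) (p : ℤ), c l * L (z ^ (j + l)) =
      t * L (z ^ j) := fun j => by
    rw [← smul_eq_mul t, ← map_smul, Complex.real_smul, ← ht, symbol, Finset.sum_mul, map_sum]
    refine Finset.sum_congr rfl fun l _ => ?_
    rw [← smul_eq_mul (c l), ← map_smul, Complex.real_smul, zpow_add₀ hz]
    congr 1
    ring
  intro n j
  have h1 : ∀ s, ∑ l ∈ Finset.Icc (-(r : ℤ)) (p : ℤ), c l * (g (n + s) * L (z ^ (j + l))) =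
      g (n + s) * (t * L (z ^ j)) := fun s => by
    rw [← hsum, Finset.mul_sum]
    exact Finset.sum_congr rfl fun l _ => by ring
  simp only [h1]
  calc _ = (∑ s ∈ Finset.range (k + 1), α s * g (n + s) +
      lam * t * ∑ s ∈ Finset.range k, β s * g (n + s)) * L (z ^ j) := by
        rw [add_mul, Finset.sum_mul, Finset.mul_sum, Finset.mul_sum, Finset.sum_mul]
        congr 1
        · exact Finset.sum_congr rfl fun s _ => by ring
        · exact Finset.sum_congr rfl fun s _ => by ring
    _ = 0 := by rw [hg, zero_mul]

/-- Stability bounds the amplitudes of the Fourier modes. -/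
theorem CauchyStable.exists_mode_bound (hαk : α k = 1) (hlam : 0 < lam)
    (hst : CauchyStable r p k c α β lam) {z : ℂ} (hz : ‖z‖ = 1) {t : ℝ}
    (ht : symbol r p c z = t) {g : ℕ → ℝ}
    (hg : ∀ n, ∑ s ∈ Finset.range (k + 1), α s * g (n + s) +
      lam * t * ∑ s ∈ Finset.range k, β s * g (n + s) = 0) :
    ∃ S : ℝ, ∀ n, g n ^ 2 ≤ S := by
  obtain ⟨K, hK, hbound⟩ := hst.exists_local_bound hαk hlam
  have hz0 : z ≠ 0 := fun h => by simp [h] at hz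
  refine ⟨K * ∑ s ∈ Finset.range k, g s ^ 2, fun n => ?_⟩
  set S := ∑ s ∈ Finset.range k, g s ^ 2 with hS
  have hS0 : 0 ≤ S := Finset.sum_nonneg fun s _ => sq_nonneg _
  -- Adding the estimates for the real and imaginary parts replaces oscillating sums by the number
  -- of points in the window.
  have hone : ∀ j : ℤ, (Complex.reLm (z ^ j)) ^ 2 + (Complex.imLm (z ^ j)) ^ 2 = 1 := fun j => by
    have := Complex.sq_norm (z ^ j)
    rw [norm_zpow, hz, one_zpow, one_pow, Complex.normSq_apply] at this
    rw [Complex.reLm_coe, Complex.imLm_coe, this]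
    ring
  have hcomb : ∀ (s N : ℕ), ∑ j ∈ Finset.Icc (-(N : ℤ)) N, (g s * Complex.reLm (z ^ j)) ^ 2 +
      ∑ j ∈ Finset.Icc (-(N : ℤ)) N, (g s * Complex.imLm (z ^ j)) ^ 2 =
        (2 * N + 1) * g s ^ 2 := fun s N => by
    rw [← Finset.sum_add_distrib, Finset.sum_congr rfl fun j _ => show _ = g s ^ 2 by
      rw [mul_pow, mul_pow, ← mul_add, hone, mul_one], Finset.sum_const, Int.card_Icc,
      nsmul_eq_mul]
    congr 1
    have : ((N : ℤ) + 1 - -(N : ℤ)).toNat = 2 * N + 1 := by omega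
    rw [this]
    push_cast
    ring
  have hM : ∀ M : ℕ, (2 * M + 1) * g n ^ 2 ≤ K * ((2 * (M + n * (r + p) : ℕ) + 1) * S) :=
    fun M => by
      have h1 := add_le_add
        (hbound _ (isCauchySolution_mode hz0 ht hg Complex.reLm) n M)
        (hbound _ (isCauchySolution_mode hz0 ht hg Complex.imLm) n M)
      simp only [hcomb, ← mul_add, ← Finset.sum_add_distrib, ← Finset.mul_sum] at h1
      exact h1
  by_contra! hlt
  have hgap := sub_pos.mpr hlt
  -- The two windows have sizes whose ratio tends to `1` as `M` grows, so a large `M` contradicts `K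
  -- * S < g n ^ 2`.
  obtain ⟨M, hM'⟩ := exists_nat_gt
    (K * (2 * (n * (r + p) : ℕ) * S) / (g n ^ 2 - K * S))
  rw [div_lt_iff₀ hgap] at hM'
  have h2 := hM M
  push_cast at h2 hM'
  have h3 : 0 ≤ (M : ℝ) * (g n ^ 2 - K * S) := by positivity
  nlinarith

/-- Intermediate value theorem between `1` and `+∞`; it turns a sign at `1` into an exponentially
growing mode. -/
theorem exists_root_gt_one_of_monic {P : ℝ[X]} (hP : P.Monic) (h1 : P.eval 1 < 0) :
    ∃ x : ℝ, 1 < x ∧ P.eval x = 0 := by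
  have hdeg : 0 < P.degree := by
    by_contra! h
    rw [hP.degree_le_zero_iff_eq_one.mp h, eval_one] at h1
    linarith
  have hlim := P.tendsto_atTop_of_leadingCoeff_nonneg hdeg (by rw [hP.leadingCoeff]; norm_num)
  obtain ⟨y, hy1, hy⟩ := ((Filter.eventually_ge_atTop 1).and (hlim.eventually_ge_atTop 0)).exists
  obtain ⟨x, hx, hx0⟩ := intermediate_value_Icc hy1 P.continuous.continuousOn ⟨h1.le, hy⟩
  refine ⟨x, lt_of_le_of_ne hx.1 ?_, hx0⟩
  rintro rfl
  simp only at hx0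
  linarith

/-- The characteristic polynomial of the time integration for the value `t` of the symbol. -/
noncomputable def timePoly (k : ℕ) (α β : ℕ → ℝ) (lam t : ℝ) : ℝ[X] :=
  X ^ k + ∑ s : Fin k, C (α s + lam * t * β s) * X ^ (s : ℕ)

theorem timePoly_monic (k : ℕ) (α β : ℕ → ℝ) (lam t : ℝ) : (timePoly k α β lam t).Monic :=
  monic_X_pow_add (degree_sum_fin_lt fun s : Fin k => α s + lam * t * β s)

theorem timePoly_eq (hαk : α k = 1) (t : ℝ) : timePoly k α β lam t =
    ∑ s ∈ Finset.range (k + 1), C (α s) * X ^ s +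
      C (lam * t) * ∑ s ∈ Finset.range k, C (β s) * X ^ s := by
  rw [timePoly, Fin.sum_univ_eq_sum_range fun s => C (α s + lam * t * β s) * X ^ s,
    Finset.sum_range_succ, hαk, Finset.mul_sum, add_right_comm, ← Finset.sum_add_distrib,
    add_comm, C_1, one_mul]
  congr 1
  refine Finset.sum_congr rfl fun s _ => ?_
  rw [C_add, C_mul (a := lam * t)]
  ring

/-- A root `x > 1` would give the amplitude `x ^ n`, which the mode bound forbids. -/
theorem CauchyStable.timePoly_eval_ne_zero (hαk : α k = 1) (hlam : 0 < lam)
    (hst : CauchyStable r p k c α β lam) {z : ℂ} (hz : ‖z‖ = 1) {t : ℝ}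
    (ht : symbol r p c z = t) {x : ℝ} (hx : 1 < x) : (timePoly k α β lam t).eval x ≠ 0 := by
  intro h0
  rw [timePoly_eq hαk] at h0
  simp only [eval_add, eval_mul, eval_finsetSum, eval_C, eval_pow, eval_X] at h0
  obtain ⟨S, hS⟩ := hst.exists_mode_bound (g := fun n => x ^ n) hαk hlam hz ht fun n => by
    have hfac : ∀ (N : ℕ) (γ : ℕ → ℝ), ∑ s ∈ Finset.range N, γ s * x ^ (n + s) =
        x ^ n * ∑ s ∈ Finset.range N, γ s * x ^ s := fun N γ => by
      rw [Finset.mul_sum]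
      exact Finset.sum_congr rfl fun s _ => by ring
    rw [hfac, hfac, mul_left_comm, ← mul_add, h0, mul_zero]
  obtain ⟨n, hn⟩ := pow_unbounded_of_one_lt S hx
  have h1 : 1 ≤ x ^ n := one_le_pow₀ hx.le
  have h2 := hS n
  nlinarith

theorem symbol_one (hspace : ∑ l ∈ Finset.Icc (-(r : ℤ)) (p : ℤ), c l = 0) :
    symbol r p c 1 = (0 : ℝ) := by
  simp only [symbol, one_zpow, mul_one]
  exact_mod_cast hspace

/-- By consistency, `∑ β` is the derivative at `1` of `∑ α_s X^s`, which vanishes at `1`. If it were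
zero, the root `1` would be double and the amplitude `n` would be a solution for `z = 1`. If it were
negative, the monic quotient by `X - 1` would be negative at `1` and have a root beyond `1`. -/
theorem CauchyStable.sum_beta_pos (hαk : α k = 1) (hlam : 0 < lam)
    (hst : CauchyStable r p k c α β lam)
    (hspace : ∑ l ∈ Finset.Icc (-(r : ℤ)) (p : ℤ), c l = 0) (htime : TimeConsistent k α β) :
    0 < ∑ s ∈ Finset.range k, β s := by
  obtain ⟨hα, hα'⟩ := htime
  have hsym := symbol_one hspace
  have hne : ∑ s ∈ Finset.range k, β s ≠ 0 := by
    intro h0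
    obtain ⟨S, hS⟩ := hst.exists_mode_bound (g := fun n => (n : ℝ)) hαk hlam norm_one hsym
      fun n => by
        simp only [mul_zero, zero_mul, add_zero]
        calc _ = (n : ℝ) * ∑ s ∈ Finset.range (k + 1), α s +
              ∑ s ∈ Finset.range (k + 1), (s : ℝ) * α s := by
              rw [Finset.mul_sum, ← Finset.sum_add_distrib]
              exact Finset.sum_congr rfl fun s _ => by push_cast; ring
          _ = 0 := by rw [hα, hα', h0, mul_zero, add_zero]
    obtain ⟨n, hn⟩ := exists_nat_gt (max S 1)
    have h1 := (le_max_left S 1).trans_lt hn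
    have h2 := (le_max_right S 1).trans_lt hn
    have h3 := hS n
    nlinarith
  by_contra hneg
  have hlt := lt_of_le_of_ne (not_lt.mp hneg) hne
  have heq := timePoly_eq (β := β) (lam := lam) hαk 0
  rw [mul_zero, C_0, zero_mul, add_zero] at heq
  have hroot : (timePoly k α β lam 0).IsRoot 1 := by
    rw [IsRoot, heq]
    simpa [eval_finsetSum] using hα
  obtain ⟨q, hq⟩ := dvd_iff_isRoot.mpr hroot
  have hmon : q.Monic := (monic_X_sub_C (1 : ℝ)).of_mul_monic_left
    (hq ▸ timePoly_monic k α β lam 0)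
  have hq1 : q.eval 1 = ∑ s ∈ Finset.range k, β s := by
    have h1 : (timePoly k α β lam 0).derivative.eval 1 = q.eval 1 := by
      rw [hq]; simp
    rw [← h1, ← hα', heq, derivative_sum, eval_finsetSum]
    refine Finset.sum_congr rfl fun s _ => ?_
    rw [derivative_C_mul_X_pow, eval_C_mul, eval_X_pow, one_pow, mul_one, mul_comm]
  obtain ⟨x, hx, hx0⟩ := exists_root_gt_one_of_monic hmon (hq1 ▸ hlt)
  exact hst.timePoly_eval_ne_zero hαk hlam norm_one hsym hx (by rw [hq, eval_mul, hx0, mul_zero])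

/-- On the unit circle, the symbol of a stable scheme avoids the negative real axis. -/
theorem CauchyStable.symbol_add_mem_slitPlane (hαk : α k = 1) (hlam : 0 < lam)
    (hst : CauchyStable r p k c α β lam)
    (hspace : ∑ l ∈ Finset.Icc (-(r : ℤ)) (p : ℤ), c l = 0) (htime : TimeConsistent k α β)
    {z : ℂ} (hz : ‖z‖ = 1) {τ : ℝ} (hτ : 0 < τ) :
    symbol r p c z + τ ∈ Complex.slitPlane := by
  rw [Complex.mem_slitPlane_iff_not_le_zero]
  intro hle
  rw [Complex.le_def] at hle
  obtain ⟨hre, him⟩ := hle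
  simp only [Complex.add_re, Complex.ofReal_re, Complex.zero_re, Complex.add_im,
    Complex.ofReal_im, add_zero, Complex.zero_im] at hre him
  have ht : symbol r p c z = ((symbol r p c z).re : ℝ) := Complex.ext (by simp) (by simp [him])
  set t := (symbol r p c z).re
  -- As `∑ α = 0`, this value is `lam * t * ∑ β`, with `t ≤ -τ < 0`.
  have hneg : (timePoly k α β lam t).eval 1 < 0 := by
    rw [timePoly_eq hαk]
    simp only [eval_add, eval_mul, eval_finsetSum, eval_C, eval_pow, eval_X, one_pow, mul_one,
      htime.1, zero_add]
    exact mul_neg_of_neg_of_pos (mul_neg_of_pos_of_neg hlam (by linarith))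
      (hst.sum_beta_pos hαk hlam hspace htime)
  obtain ⟨x, hx, hx0⟩ := exists_root_gt_one_of_monic (timePoly_monic k α β lam t) hneg
  exact hst.timePoly_eval_ne_zero hαk hlam hz ht hx hx0

end MultistepScheme

/-! ### Locating the roots of the flux polynomial. -/

namespace MultistepScheme

open Polynomial Filter

/-- In both cases the squares differ by `δ ^ 2 + 2 * δ * (1 - z.re)`. These are the two ways of
pushing the root `1` off the circle, to `(1 + δ)⁻¹` or to `1 + δ`. -/
theorem norm_sub_one_lt {z : ℂ} (hz : ‖z‖ = 1) {δ : ℝ} (hδ : 0 < δ) :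
    ‖z - 1‖ < ‖(1 + δ : ℂ) * z - 1‖ ∧ ‖z - 1‖ < ‖z - (1 + δ : ℂ)‖ := by
  have h1 : z.re * z.re + z.im * z.im = 1 := by
    rw [← Complex.normSq_apply, ← Complex.sq_norm, hz, one_pow]
  have h2 : z.re ≤ 1 := hz ▸ Complex.re_le_norm z
  have h3 : δ * (z.re * z.re + z.im * z.im) = δ := by rw [h1, mul_one]
  have h4 : δ ^ 2 * (z.re * z.re + z.im * z.im) = δ ^ 2 := by rw [h1, mul_one]
  have h5 : 0 ≤ δ * (1 - z.re) := mul_nonneg hδ.le (sub_nonneg.mpr h2)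
  constructor <;> refine lt_of_pow_lt_pow_left₀ 2 (norm_nonneg _) ?_ <;>
    rw [Complex.sq_norm, Complex.sq_norm, Complex.normSq_apply, Complex.normSq_apply] <;>
    simp <;> nlinarith

theorem diskRootCount_mul {P Q : ℂ[X]} (h : P * Q ≠ 0) :
    diskRootCount (P * Q) = diskRootCount P + diskRootCount Q := by
  rw [diskRootCount, roots_mul h, Multiset.countP_add]; rfl

theorem diskRootCount_X_pow (n : ℕ) : diskRootCount (X ^ n) = n := by
  rw [diskRootCount, roots_X_pow, Multiset.nsmul_singleton, Multiset.countP_eq_card.mpr]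
  · simp
  · intro z hz
    simp [Multiset.eq_of_mem_replicate hz]

theorem diskRootCount_C_mul_X_sub_C {b : ℂ} (hb : b ≠ 0) (d : ℂ) :
    diskRootCount (C b * (X - C d)) = if ‖d‖ < 1 then 1 else 0 := by
  rw [diskRootCount, roots_C_mul _ hb, roots_X_sub_C, Multiset.countP_eq_card_filter,
    Multiset.filter_singleton]
  split_ifs <;> simp

/-- Moving a simple root at `1` off the unit circle. -/
theorem exists_diskRootCount_perturb (f E : ℂ[X]) (hf : ∀ z : ℂ, ‖z‖ = 1 → f.eval z ≠ 0) :
    ∃ δ : ℝ, 0 < δ ∧ ∀ D : ℂ[X], (∀ z : ℂ, ‖z‖ = 1 → ‖z - 1‖ < ‖D.eval z‖) →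
      diskRootCount (D * f + C (δ : ℂ) * ((X - 1) * E)) = diskRootCount (D * f) := by
  have hcomp := isCompact_sphere (0 : ℂ) 1
  have hmem : ∀ {z : ℂ}, ‖z‖ = 1 → z ∈ Metric.sphere (0 : ℂ) 1 := fun h => by simpa using h
  obtain ⟨K, hK⟩ := hcomp.exists_bound_of_continuousOn E.continuous.continuousOn
  obtain ⟨y, hy, hmin⟩ := hcomp.exists_isMinOn ⟨1, by simp⟩ f.continuous.norm.continuousOn
  have hm : 0 < ‖f.eval y‖ := norm_pos_iff.mpr (hf y (by simpa using hy))
  have hK0 : 0 ≤ K := (norm_nonneg _).trans (hK 1 (by simp))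
  -- The choice ensures `δ * sup |E| < min |f|` on the circle. It is made before `D`, since `D` will
  -- depend on `δ`.
  refine ⟨‖f.eval y‖ / (K + 1), by positivity, fun D hD => ?_⟩
  set δ := ‖f.eval y‖ / (K + 1) with hδ
  have hδ0 : 0 < δ := by positivity
  have hδK : δ * K < ‖f.eval y‖ := by
    rw [hδ, div_mul_eq_mul_div, div_lt_iff₀ (by positivity)]
    nlinarith
  refine diskRootCount_eq_of_div_mem_slitPlane _ _ fun z hz => ?_
  have hDz : 0 < ‖D.eval z‖ := (norm_nonneg _).trans_lt (hD z hz)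
  have hD0 : D.eval z ≠ 0 := norm_pos_iff.mp hDz
  have hfz : ‖f.eval y‖ ≤ ‖f.eval z‖ := hmin (hmem hz)
  have hq : (D * f + C (δ : ℂ) * ((X - 1) * E)).eval z / (D * f).eval z =
      1 + δ * ((z - 1) * E.eval z) / (D.eval z * f.eval z) := by
    have := hf z hz
    simp only [eval_add, eval_mul, eval_sub, eval_C, eval_X, eval_one]
    field_simp
  rw [hq]
  refine Complex.mem_slitPlane_of_norm_lt_one ?_
  rw [norm_div, norm_mul, norm_mul, norm_mul, Complex.norm_real, Real.norm_of_nonneg hδ0.le,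
    div_lt_one (mul_pos hDz (hm.trans_le hfz))]
  calc δ * (‖z - 1‖ * ‖E.eval z‖) ≤ δ * (‖D.eval z‖ * K) := by
        gcongr
        · exact (hD z hz).le
        · exact hK z (hmem hz)
    _ = ‖D.eval z‖ * (δ * K) := by ring
    _ < ‖D.eval z‖ * ‖f.eval z‖ := mul_lt_mul_of_pos_left (hδK.trans_le hfz) hDz

/-- The characteristic polynomial of the numerical flux. -/
noncomputable def fluxPoly (r p : ℕ) (c : ℤ → ℝ) : ℂ[X] :=
  ∑ i : Fin (r + p), C (fluxCoeff r c ((i : ℤ) - r) : ℂ) * X ^ (i : ℕ)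

variable {r p k : ℕ} {c : ℤ → ℝ} {α β : ℕ → ℝ} {lam a : ℝ}

theorem fluxPoly_eval (z : ℂ) : (fluxPoly r p c).eval z =
    ∑ i : Fin (r + p), (fluxCoeff r c ((i : ℤ) - r) : ℂ) * z ^ (i : ℕ) := by
  simp [fluxPoly, eval_finsetSum]

/-- This is the conservative form applied to the real and imaginary parts of `z ^ j`. It is taken at
`j = r`, where all exponents are nonnegative. -/
theorem pow_mul_symbol (hc : ∑ l ∈ Finset.Icc (-(r : ℤ)) (p : ℤ), c l = 0) {z : ℂ} (hz : z ≠ 0) :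
    z ^ r * symbol r p c z = (z - 1) * (fluxPoly r p c).eval z := by
  have key : ∀ L : ℂ →ₗ[ℝ] ℝ, L (z ^ r * symbol r p c z) = L ((z - 1) * (fluxPoly r p c).eval z) :=
    fun L => by
      have h := numericalFlux_conservative r p c hc (fun j => L (z ^ j)) r
      have h1 : ∀ l : ℤ, (c l : ℂ) * z ^ ((r : ℤ) + l) = z ^ r * ((c l : ℂ) * z ^ l) := fun l => by
        rw [zpow_add₀ hz, zpow_natCast]; ring
      have h2 : ∀ i : ℕ, z ^ ((r : ℤ) - r + 1 + i) - z ^ ((r : ℤ) - r + i) = (z - 1) * z ^ i :=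
        fun i => by
          rw [sub_self, zero_add, zero_add, zpow_add₀ hz, zpow_one, zpow_natCast]; ring
      have h3 : ∀ (b : ℝ) (y : ℂ), b * L y = L ((b : ℂ) * y) := fun b y => by
        rw [← smul_eq_mul, ← map_smul, Complex.real_smul]
      simp only [numericalFlux, h3, ← Finset.sum_sub_distrib, ← map_sub, ← mul_sub, h1, h2] at h
      simp only [← map_sum] at h
      rw [← Finset.mul_sum] at h
      rw [symbol, h, fluxPoly_eval, Finset.mul_sum]
      congr 1
      exact Finset.sum_congr rfl fun i _ => by ring
  exact Complex.ext (key Complex.reLm) (key Complex.imLm)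

/-- The conservative form applied to the sequence `x_j = j`, whose increments are all `1`. -/
theorem sum_fluxCoeff (hs : SpaceConsistent r p c a) :
    ∑ i : Fin (r + p), fluxCoeff r c ((i : ℤ) - r) = a := by
  have h := numericalFlux_conservative r p c hs.1 (fun j => (j : ℝ)) 0
  simp only [numericalFlux, ← Finset.sum_sub_distrib, ← mul_sub] at h
  have h1 : ∑ l ∈ Finset.Icc (-(r : ℤ)) (p : ℤ), c l * ((0 + l : ℤ) : ℝ) = a := by
    rw [← hs.2]
    exact Finset.sum_congr rfl fun l _ => by rw [zero_add, mul_comm]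
  rw [← h1, h]
  exact Finset.sum_congr rfl fun i _ => by push_cast; ring

theorem fluxPoly_eval_one (hs : SpaceConsistent r p c a) : (fluxPoly r p c).eval 1 = a := by
  rw [fluxPoly_eval, ← sum_fluxCoeff hs]
  simp

theorem fluxPoly_eval_ne_zero (ha : a ≠ 0) (hs : SpaceConsistent r p c a)
    (hcircle : NoOtherRootOnCircle r p c) {z : ℂ} (hz : ‖z‖ = 1) :
    (fluxPoly r p c).eval z ≠ 0 := by
  by_cases h1 : z = 1
  · rw [h1, fluxPoly_eval_one hs]
    exact_mod_cast ha
  · have hexp : Complex.exp (Complex.I * (z.arg : ℂ)) = z := by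
      have := Complex.norm_mul_exp_arg_mul_I z
      rwa [hz, Complex.ofReal_one, one_mul, mul_comm] at this
    have hne := hcircle z.arg ⟨(Complex.neg_pi_lt_arg z).le, Complex.arg_le_pi z⟩ fun h0 => by
      rw [h0, Complex.ofReal_zero, mul_zero, Complex.exp_zero] at hexp
      exact h1 hexp.symm
    rw [hexp] at hne
    have hz0 : z ≠ 0 := fun h => by simp [h] at hz
    intro h0
    have h2 := pow_mul_symbol hs.1 hz0
    rw [h0, mul_zero] at h2
    exact mul_ne_zero (pow_ne_zero r hz0) hne h2

theorem fluxPoly_ne_zero (ha : a ≠ 0) (hs : SpaceConsistent r p c a) : fluxPoly r p c ≠ 0 := by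
  intro h
  have h1 := fluxPoly_eval_one hs
  rw [h, eval_zero] at h1
  exact ha (by exact_mod_cast h1.symm)

/-- Rouché against `X ^ r`: on the circle the quotient is `𝒜(z) + τ`, which stability keeps in the
slit plane. -/
theorem diskRootCount_add_X_pow (hαk : α k = 1) (hlam : 0 < lam)
    (hst : CauchyStable r p k c α β lam) (hs : SpaceConsistent r p c a)
    (htime : TimeConsistent k α β) {τ : ℝ} (hτ : 0 < τ) :
    diskRootCount ((X - 1) * fluxPoly r p c + C (τ : ℂ) * X ^ r) = r := by
  rw [diskRootCount_eq_of_div_mem_slitPlane _ (X ^ r), diskRootCount_X_pow]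
  intro z hz
  have hz0 : z ≠ 0 := fun h => by simp [h] at hz
  convert hst.symbol_add_mem_slitPlane hαk hlam hs.1 htime hz hτ using 1
  simp only [eval_add, eval_mul, eval_sub, eval_C, eval_X, eval_one, eval_pow]
  rw [← pow_mul_symbol hs.1 hz0]
  have := pow_ne_zero r hz0
  field_simp

/-- With `D = (1 + δ) X - 1` and `(X - 1) E = a X^r - X f`, the perturbed polynomial `D f + δ (X -
1) E` is exactly `(X - 1) f + a δ X^r`, which has `r` roots in the disk. The root `(1 + δ)⁻¹` of `D`
accounts for one of them. -/
theorem diskRootCount_fluxPoly_of_pos (ha : 0 < a) (hαk : α k = 1) (hlam : 0 < lam)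
    (hst : CauchyStable r p k c α β lam) (hs : SpaceConsistent r p c a)
    (htime : TimeConsistent k α β) (hcircle : NoOtherRootOnCircle r p c) :
    diskRootCount (fluxPoly r p c) + 1 = r := by
  have hroot : (C (a : ℂ) * X ^ r - X * fluxPoly r p c).IsRoot 1 := by
    simp [fluxPoly_eval_one hs]
  obtain ⟨E, hE⟩ := dvd_iff_isRoot.mpr hroot
  rw [C_1] at hE
  obtain ⟨δ, hδ, hD⟩ := exists_diskRootCount_perturb (fluxPoly r p c) E
    fun z hz => fluxPoly_eval_ne_zero ha.ne' hs hcircle hz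
  have hδ1 : (1 + δ : ℂ) ≠ 0 := by exact_mod_cast (by positivity : (1 + δ : ℝ) ≠ 0)
  have h1 := hD (C (1 + δ : ℂ) * (X - C (1 + δ : ℂ)⁻¹)) fun z hz => by
    simp only [eval_mul, eval_sub, eval_C, eval_X, mul_sub, mul_inv_cancel₀ hδ1]
    exact (norm_sub_one_lt hz hδ).1
  have hnorm : ‖(1 + δ : ℂ)⁻¹‖ < 1 := by
    rw [norm_inv, ← Complex.ofReal_one, ← Complex.ofReal_add, Complex.norm_real,
      Real.norm_of_nonneg (by positivity)]
    exact inv_lt_one_of_one_lt₀ (by linarith)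
  have hne : C (1 + δ : ℂ) * (X - C (1 + δ : ℂ)⁻¹) * fluxPoly r p c ≠ 0 :=
    mul_ne_zero (mul_ne_zero (C_ne_zero.mpr hδ1) (X_sub_C_ne_zero _))
      (fluxPoly_ne_zero ha.ne' hs)
  rw [diskRootCount_mul hne, diskRootCount_C_mul_X_sub_C hδ1, if_pos hnorm, ← hE] at h1
  rw [add_comm, ← h1]
  refine Eq.trans (congrArg diskRootCount ?_)
    (diskRootCount_add_X_pow hαk hlam hst hs htime (mul_pos ha hδ))
  rw [mul_sub, ← C_mul, mul_inv_cancel₀ hδ1]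
  simp only [Complex.ofReal_mul, C_mul, C_add, C_1]
  ring

/-- Here `D = X - (1 + δ)` and `(X - 1) E = -a X^r + f`, so that `D f + δ (X - 1) E = (X - 1) f - a
δ X^r` has a positive coefficient `τ = -a δ`. The root of `D` now lies outside and contributes
nothing. -/
theorem diskRootCount_fluxPoly_of_neg (ha : a < 0) (hαk : α k = 1) (hlam : 0 < lam)
    (hst : CauchyStable r p k c α β lam) (hs : SpaceConsistent r p c a)
    (htime : TimeConsistent k α β) (hcircle : NoOtherRootOnCircle r p c) :
    diskRootCount (fluxPoly r p c) = r := by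
  have hroot : (C (-a : ℂ) * X ^ r + fluxPoly r p c).IsRoot 1 := by
    simp [fluxPoly_eval_one hs]
  obtain ⟨E, hE⟩ := dvd_iff_isRoot.mpr hroot
  rw [C_1] at hE
  obtain ⟨δ, hδ, hD⟩ := exists_diskRootCount_perturb (fluxPoly r p c) E
    fun z hz => fluxPoly_eval_ne_zero ha.ne hs hcircle hz
  have h1 := hD (C 1 * (X - C (1 + δ : ℂ))) fun z hz => by
    simp only [eval_mul, eval_sub, eval_C, eval_X, one_mul]
    exact (norm_sub_one_lt hz hδ).2
  have hnorm : ¬ ‖(1 + δ : ℂ)‖ < 1 := by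
    rw [← Complex.ofReal_one, ← Complex.ofReal_add, Complex.norm_real,
      Real.norm_of_nonneg (by positivity)]
    linarith
  have hne : C 1 * (X - C (1 + δ : ℂ)) * fluxPoly r p c ≠ 0 :=
    mul_ne_zero (mul_ne_zero (C_ne_zero.mpr one_ne_zero) (X_sub_C_ne_zero _))
      (fluxPoly_ne_zero ha.ne hs)
  rw [diskRootCount_mul hne, diskRootCount_C_mul_X_sub_C one_ne_zero, if_neg hnorm, zero_add,
    ← hE] at h1
  rw [← h1]
  refine Eq.trans (congrArg diskRootCount ?_)
    (diskRootCount_add_X_pow hαk hlam hst hs htime (mul_pos (neg_pos.mpr ha) hδ))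
  simp only [Complex.ofReal_mul, Complex.ofReal_neg, C_mul, C_add, C_1, C_neg]
  ring

/-! ### Boundary layer profiles as solutions of the recurrence of the disk factor. -/

/-- The monic factor of a polynomial that carries its roots in the open unit disk. -/
noncomputable def diskFactor (P : ℂ[X]) : ℂ[X] :=
  ((P.roots.filter fun z => ‖z‖ < 1).map fun z => X - C z).prod

theorem diskFactor_monic (P : ℂ[X]) : (diskFactor P).Monic :=
  monic_multisetProd_X_sub_C _

theorem natDegree_diskFactor (P : ℂ[X]) : (diskFactor P).natDegree = diskRootCount P := by
  rw [diskFactor, natDegree_multiset_prod_X_sub_C_eq_card, diskRootCount,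
    Multiset.countP_eq_card_filter]

theorem eq_mul_diskFactor (P : ℂ[X]) : P = C P.leadingCoeff *
    (((P.roots.filter fun z => ¬ ‖z‖ < 1).map fun z => X - C z).prod * diskFactor P) := by
  rw [diskFactor, mul_comm (Multiset.prod _), ← Multiset.prod_add, ← Multiset.map_add,
    Multiset.filter_add_not]
  exact (IsAlgClosed.splits P).eq_prod_roots

theorem aeval_shift_of_diskFactor {P : ℂ[X]} {v : ℕ → ℂ} (h : aeval shift (diskFactor P) v = 0) :
    aeval shift P v = 0 := by
  rw [eq_mul_diskFactor P, ← mul_assoc, map_mul, Module.End.mul_apply, h, map_zero]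

/-- The disk factor maps `v` to a null sequence annihilated by the complementary factor, whose roots
have modulus at least `1`; such a sequence is zero. -/
theorem aeval_shift_diskFactor_eq_zero {P : ℂ[X]} (hP : P ≠ 0) {v : ℕ → ℂ}
    (hv : Tendsto v atTop (nhds 0)) (h : aeval shift P v = 0) :
    aeval shift (diskFactor P) v = 0 := by
  rw [eq_mul_diskFactor P, map_mul, map_mul, Module.End.mul_apply, Module.End.mul_apply,
    aeval_C, Module.algebraMap_end_apply] at h
  refine eq_zero_of_aeval_shift_of_one_le _ (fun z hz => ?_) (tendsto_aeval_shift _ hv)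
    ((smul_eq_zero.mp h).resolve_left (leadingCoeff_ne_zero.mpr hP))
  exact not_lt.mp (Multiset.mem_filter.mp hz).2

theorem aeval_shift_fluxPoly_apply (v : ℕ → ℂ) (n : ℕ) : aeval shift (fluxPoly r p c) v n =
    ∑ i : Fin (r + p), (fluxCoeff r c ((i : ℤ) - r) : ℂ) * v (n + i) := by
  simp [fluxPoly, shift_pow_apply]

theorem numericalFlux_eq_iff (u : ℝ) (v : ℕ → ℝ) (j : ℕ) :
    numericalFlux r p c (fun i => u + v (j + i)) = numericalFlux r p c (fun _ => u) ↔
      ∑ i : Fin (r + p), fluxCoeff r c ((i : ℤ) - r) * v (j + i) = 0 := by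
  simp only [numericalFlux, mul_add, Finset.sum_add_distrib]
  exact add_eq_left

namespace IsBoundaryLayerProfile

variable {u : ℝ} {v : ℕ → ℝ}

theorem tendsto_ofReal (h : IsBoundaryLayerProfile r p c u v) :
    Tendsto (fun n => (v n : ℂ)) atTop (nhds 0) := by
  have := (Complex.continuous_ofReal.tendsto 0).comp h.limit
  rwa [Complex.ofReal_zero] at this

theorem aeval_shift (h : IsBoundaryLayerProfile r p c u v) :
    aeval shift (fluxPoly r p c) (fun n => (v n : ℂ)) = 0 := by
  funext n
  rw [aeval_shift_fluxPoly_apply, Pi.zero_apply]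
  exact_mod_cast (numericalFlux_eq_iff u v n).mp (h.flux n)

theorem aeval_shift_diskFactor (h : IsBoundaryLayerProfile r p c u v)
    (hf : fluxPoly r p c ≠ 0) :
    Polynomial.aeval shift (diskFactor (fluxPoly r p c)) (fun n => (v n : ℂ)) = 0 :=
  aeval_shift_diskFactor_eq_zero hf h.tendsto_ofReal h.aeval_shift

theorem decaysExponentially (h : IsBoundaryLayerProfile r p c u v) (hf : fluxPoly r p c ≠ 0) :
    DecaysExponentially v := by
  obtain ⟨K, ρ, hK, h0, h1, hb⟩ := exists_exponential_bound _
    (fun z hz => (Multiset.mem_filter.mp hz).2) (h.aeval_shift_diskFactor hf)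
  exact ⟨K, ρ, hK, h0, h1, fun j => by simpa using hb j⟩

/-- The difference `v - u w` solves a recurrence of order at most `r` and vanishes at the first `r`
indices. -/
theorem eq_mul {w : ℕ → ℝ} (h : IsBoundaryLayerProfile r p c u v)
    (hw : IsBoundaryLayerProfile r p c 1 w) (hf : fluxPoly r p c ≠ 0)
    (hcount : diskRootCount (fluxPoly r p c) ≤ r) (j : ℕ) : v j = u * w j := by
  have h0 := eq_zero_of_aeval_shift_of_initial (diskFactor_monic (fluxPoly r p c))
    (v := (fun n => (v n : ℂ)) - (u : ℂ) • fun n => (w n : ℂ))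
    (by rw [map_sub, map_smul, h.aeval_shift_diskFactor hf, hw.aeval_shift_diskFactor hf,
      smul_zero, sub_zero])
    (fun i hi => by
      rw [natDegree_diskFactor] at hi
      simp [h.boundary i (hi.trans_le hcount), hw.boundary i (hi.trans_le hcount)])
  have h1 := congrFun h0 j
  simp only [Pi.sub_apply, Pi.smul_apply, smul_eq_mul, Pi.zero_apply, sub_eq_zero] at h1
  exact_mod_cast h1

theorem eq_zero_of_count_lt (h : IsBoundaryLayerProfile r p c u v) (hf : fluxPoly r p c ≠ 0)
    (hf1 : (fluxPoly r p c).eval 1 ≠ 0) (hcount : diskRootCount (fluxPoly r p c) < r) :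
    u = 0 ∧ ∀ j, v j = 0 := by
  have hQ := h.aeval_shift_diskFactor hf
  set Q := diskFactor (fluxPoly r p c) with hQdef
  -- The disk factor `Q` has degree less than `r`, so its recurrence at index `0` involves boundary
  -- values only and reads `-u * Q(1) = 0`. Since `Q` divides `f` and `f(1) ≠ 0`, also `Q(1) ≠ 0`.
  have hu : u = 0 := by
    have h0 := congrFun hQ 0
    rw [aeval_shift_apply, Finset.sum_congr rfl fun i hi => by
      rw [zero_add, h.boundary i (by
        rw [Finset.mem_range, natDegree_diskFactor] at hi; omega)], ← Finset.sum_mul] at h0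
    have h1 : ∑ i ∈ Finset.range (Q.natDegree + 1), Q.coeff i = Q.eval 1 := by
      simp [eval_eq_sum_range]
    have h2 : Q.eval 1 ≠ 0 := fun hz => hf1 (by
      rw [eq_mul_diskFactor (fluxPoly r p c), eval_mul, eval_mul, ← hQdef, hz, mul_zero, mul_zero])
    rw [h1] at h0
    simpa using (mul_eq_zero.mp h0).resolve_left h2
  refine ⟨hu, fun j => ?_⟩
  have h0 := eq_zero_of_aeval_shift_of_initial (diskFactor_monic (fluxPoly r p c)) hQ
    fun i hi => by
      rw [natDegree_diskFactor] at hi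
      simp [h.boundary i (hi.trans hcount), hu]
  exact Complex.ofReal_eq_zero.mp (congrFun h0 j)

theorem zero : IsBoundaryLayerProfile r p c 0 fun _ => 0 where
  boundary _ _ := by simp
  flux _ := by simp
  limit := tendsto_const_nhds

theorem exists_of_count_eq (hcount : diskRootCount (fluxPoly r p c) = r) (u : ℝ) :
    ∃ v, IsBoundaryLayerProfile r p c u v := by
  obtain ⟨v, hv, hv0⟩ := exists_aeval_shift_eq_zero (diskFactor_monic (fluxPoly r p c)) (-u : ℂ)
  obtain ⟨K, ρ, -, h0, h1, hb⟩ := exists_exponential_bound _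
    (fun z hz => (Multiset.mem_filter.mp hz).2) hv
  rw [natDegree_diskFactor, hcount] at hv0
  -- The disk factor yields a complex solution; its real part is still a solution because the flux
  -- coefficients are real.
  refine ⟨fun n => (v n).re, fun j hj => by simp [hv0 j hj], fun j => ?_, ?_⟩
  · refine (numericalFlux_eq_iff u (fun n => (v n).re) j).mpr ?_
    have := congrArg Complex.re (congrFun (aeval_shift_of_diskFactor hv) j)
    rw [aeval_shift_fluxPoly_apply, Complex.re_sum] at this
    simpa using this
  · refine squeeze_zero_norm (fun n => (Complex.abs_re_le_norm _).trans (hb n)) ?_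
    simpa using (tendsto_pow_atTop_nhds_zero_of_lt_one h0.le h1).const_mul K

end IsBoundaryLayerProfile

end MultistepScheme

/-! ### The two signs of the velocity. -/

theorem proposition2p1
    (r p k : ℕ) (c : ℤ → ℝ) (α β : ℕ → ℝ) (a lam : ℝ)
    (hcr : c (-(r : ℤ)) ≠ 0) (hcp : c (p : ℤ) ≠ 0)
    (hk : 1 ≤ k) (hαk : α k = 1) (hαβ : 0 < |α 0| + |β 0|)
    (hlam : 0 < lam)
    (hspace : MultistepScheme.SpaceConsistent r p c a)
    (htime : MultistepScheme.TimeConsistent k α β)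
    (hstable : MultistepScheme.CauchyStable r p k c α β lam)
    (hcircle : MultistepScheme.NoOtherRootOnCircle r p c) :
    (0 < a →
      MultistepScheme.Cnum r p c = {0} ∧
      ∀ v : ℕ → ℝ, MultistepScheme.IsBoundaryLayerProfile r p c 0 v ↔ ∀ j : ℕ, v j = 0) ∧
    (a < 0 →
      MultistepScheme.Cnum r p c = Set.univ ∧
      (∀ u : ℝ, ∃! v : ℕ → ℝ, MultistepScheme.IsBoundaryLayerProfile r p c u v) ∧
      (∀ (u : ℝ) (v : ℕ → ℝ), MultistepScheme.IsBoundaryLayerProfile r p c u v →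
        MultistepScheme.DecaysExponentially v) ∧
      (∀ w : ℕ → ℝ, MultistepScheme.IsBoundaryLayerProfile r p c 1 w →
        ∀ (u : ℝ) (v : ℕ → ℝ), MultistepScheme.IsBoundaryLayerProfile r p c u v →
          ∀ j : ℕ, v j = u * w j)) := by
  constructor
  · intro ha
    have hf := MultistepScheme.fluxPoly_ne_zero ha.ne' hspace
    have hf1 := MultistepScheme.fluxPoly_eval_ne_zero ha.ne' hspace hcircle norm_one
    have hcount : MultistepScheme.diskRootCount (MultistepScheme.fluxPoly r p c) < r := by
      have := MultistepScheme.diskRootCount_fluxPoly_of_pos ha hαk hlam hstable hspace htime hcircle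
      omega
    refine ⟨Set.ext fun u => ⟨fun ⟨v, hv⟩ => (hv.eq_zero_of_count_lt hf hf1 hcount).1, ?_⟩,
      fun v => ⟨fun hv => (hv.eq_zero_of_count_lt hf hf1 hcount).2, fun hv => ?_⟩⟩
    · rintro rfl
      exact ⟨_, MultistepScheme.IsBoundaryLayerProfile.zero⟩
    · rw [funext hv]
      exact MultistepScheme.IsBoundaryLayerProfile.zero
  · intro ha
    have hf := MultistepScheme.fluxPoly_ne_zero ha.ne hspace
    have hcount :=
      MultistepScheme.diskRootCount_fluxPoly_of_neg ha hαk hlam hstable hspace htime hcircle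
    have hex := MultistepScheme.IsBoundaryLayerProfile.exists_of_count_eq hcount
    refine ⟨Set.eq_univ_of_forall hex, fun u => ?_, fun u v hv => hv.decaysExponentially hf,
      fun w hw u v hv => hv.eq_mul hw hf hcount.le⟩
    obtain ⟨v, hv⟩ := hex u
    obtain ⟨w, hw⟩ := hex 1
    -- Uniqueness follows from proportionality: any two profiles for `u` equal `u * w`.
    exact ⟨v, hv, fun v' hv' => funext fun j =>
      (hv'.eq_mul hw hf hcount.le j).trans (hv.eq_mul hw hf hcount.le j).symm⟩
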